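/- Let $X$ and $Y$ be separable Banach spaces (over $\mathbb{R}$ or $\mathbb{C}$), and let $\mathcal{L}(X,Y)$ be the space of bounded linear operators from $X$ to $Y$. An operator $T\in\mathcal{L}(X,Y)$ is strictly singular, $T\in\mathcal{SS}(X,Y)$, if for no infinite dimensional closed subspace $Z$ of $X$ is the restriction $T|_Z$ an isomorphism onto its image. The Schreier families $\mathcal{S}_\xi$, $0\le\xi<\omega_1$, of finite subsets of $\mathbb{N}=\{1,2,\dots\}$ are defined by $\mathcal{S}_0=\{\{n\}:n\in\mathbb{N}\}\cup\{\emptyset\}$; $\mathcal{S}_{\zeta+1}=\{\bigcup_{i=1}^n F_i : n\ge 1,\ n\le F_1<\dots<F_n,\ F_i\in\mathcal{S}_\zeta\}\cup\{\emptyset\}$; and, for a limit ordinal $\xi<\omega_1$, $\mathcal{S}_\xi=\bigcup_{n\ge1}\{F\in\mathcal{S}_{\xi_n}: n\le F\}$, where for each such $\xi$ a (not necessarily strictly) increasing sequence $(\xi_n)_{n\ge1}$ of ordinals below $\xi$ with limit $\xi$ has been fixed. Here $A<B$ means that $a<b$ for all $a\in A$, $b\in B$, the relation is required between $F_i$ and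 $F_j$ for all $i<j$, and $n\le F$ means that $n\le k$ for all $k\in F$ (with $n\le F_1<\dots<F_n$ including $n\le F_i$ for every $i$). For $1\le\xi<\omega_1$ let $\mathcal{SS}_\xi(X,Y)$ be the set of all $T\in\mathcal{L}(X,Y)$ such that for every $\varepsilon>0$ and every normalized basic sequence $(x_n)_{n\ge1}$ in $X$ there are $F\in\mathcal{S}_\xi$ and a nonzero vector $x$ in the linear span of $\{x_n:n\in F\}$ with $\|Tx\|<\varepsilon\|x\|$. Then, for every choice of the sequences $(\xi_n)$ in the definition of the Schreier families: 1. If $\mathcal{L}(X,Y)=\mathcal{SS}(X,Y)$, then there is an ordinal $1\le\xi<\omega_1$ with $\mathcal{SS}_\xi(X,Y)=\mathcal{SS}(X,Y)$. 2. In particular, this applies when $X$ and $Y$ are totally incomparable, i.e. when no infinite dimensional closed subspace of $X$ is isomorphic to a closed subspace of $Y$: in that case $\mathcal{L}(X,Y)=\mathcal{SS}(X,Y)$, and hence $\mathcal{SS}_\xi(X,Y)=\mathcal{SS}(X,Y)$ for some $1\le\xi<\omega_1$. -/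

import Mathlib

open scoped Ordinal

/-- A choice, for every countable limit ordinal `ξ`, of a
(not necessarily strictly) increasing sequence `(ξ_n)_{n ≥ 1}` of
ordinals below `ξ` with limit `ξ`. The Schreier families are built from such a choice.
The values of `seq` at other ordinals are irrelevant. -/
structure LimitApproximation where
  seq : Ordinal.{0} → ℕ+ → Ordinal.{0}
  seq_monotone : ∀ ξ, Order.IsSuccLimit ξ → ξ < ω₁ → Monotone (seq ξ)
  seq_lt : ∀ ξ, Order.IsSuccLimit ξ → ξ < ω₁ → ∀ n, seq ξ n < ξ
  seq_cofinal : ∀ ξ, Order.IsSuccLimit ξ → ξ < ω₁ → ∀ η < ξ, ∃ n, η < seq ξ n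

/-- Such choices exist. -/
instance : Nonempty LimitApproximation := by
  have key : ∀ ξ : Ordinal.{0}, ∃ f : ℕ+ → Ordinal.{0}, Order.IsSuccLimit ξ → ξ < ω₁ →
      Monotone f ∧ (∀ n, f n < ξ) ∧ ∀ η < ξ, ∃ n, η < f n := by
    intro ξ
    by_cases h : Order.IsSuccLimit ξ ∧ ξ < ω₁
    · obtain ⟨hl, hc⟩ := h
      have hcof : ξ.cof.ord = ω := by
        rw [Ordinal.cof_eq_aleph0_of_isSuccLimit hl hc, Cardinal.ord_aleph0]
      obtain ⟨f, hf⟩ := Ordinal.exists_isFundamentalSeq hcof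
      refine ⟨fun n => (f ⟨((n : ℕ) : Ordinal), Ordinal.natCast_lt_omega0 _⟩).1,
        fun _ _ => ⟨?_, fun n => (f _).2, ?_⟩⟩
      · intro m n hmn
        apply hf.strictMono.monotone
        change ((m : ℕ) : Ordinal) ≤ ((n : ℕ) : Ordinal)
        exact_mod_cast hmn
      · intro η hη
        obtain ⟨_, ⟨⟨c, hc'⟩, rfl⟩, hle⟩ := hf.isCofinal_range ⟨η, hη⟩
        obtain ⟨k, rfl⟩ := Ordinal.lt_omega0.1 hc'
        refine ⟨k.succPNat, lt_of_le_of_lt hle ?_⟩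
        apply hf.strictMono
        change (k : Ordinal) < ((k.succPNat : ℕ) : Ordinal)
        exact_mod_cast Nat.lt_succ_self k
    · exact ⟨fun _ => 0, fun h1 h2 => absurd ⟨h1, h2⟩ h⟩
  choose f hf using key
  exact ⟨⟨f, fun ξ h h' => (hf ξ h h').1, fun ξ h h' => (hf ξ h h').2.1,
    fun ξ h h' => (hf ξ h h').2.2⟩⟩

/-- The Schreier families `S_ξ`, `ξ < ω₁`, of finite subsets of `{1, 2, 3, …}`:
`S_0` consists of `∅` and the singletons; `S_{ζ+1}` consists of `∅` and the unions
`F_1 ∪ ⋯ ∪ F_n` with `n ≥ 1`, `n ≤ F_1 < ⋯ < F_n`, `F_i ∈ S_ζ`; and for limit `ξ`, `S_ξ` is the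
union over `n ≥ 1` of `{F ∈ S_{ξ_n} : n ≤ F}`. -/
noncomputable def schreier (s : LimitApproximation) (ξ : Ordinal.{0}) : Set (Finset ℕ+) :=
  Ordinal.limitRecOn (motive := fun _ => Set (Finset ℕ+)) ξ
    ({F | ∃ n : ℕ+, F = {n}} ∪ {∅})
    (fun _ S => {G | ∃ (n : ℕ+) (F : Fin n → Finset ℕ+),
        (∀ i, F i ∈ S) ∧ (∀ i, ∀ k ∈ F i, n ≤ k) ∧
        (∀ i j, i < j → ∀ a ∈ F i, ∀ b ∈ F j, a < b) ∧
        G = Finset.univ.biUnion F} ∪ {∅})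
    (fun ξ _ S => {F | ∃ (n : ℕ+) (h : s.seq ξ n < ξ), F ∈ S (s.seq ξ n) h ∧ ∀ k ∈ F, n ≤ k})

theorem schreier_zero (s : LimitApproximation) :
    schreier s 0 = {F | ∃ n : ℕ+, F = {n}} ∪ {∅} := by
  simp [schreier]

theorem schreier_add_one (s : LimitApproximation) (ζ : Ordinal.{0}) :
    schreier s (ζ + 1) = {G | ∃ (n : ℕ+) (F : Fin n → Finset ℕ+),
        (∀ i, F i ∈ schreier s ζ) ∧ (∀ i, ∀ k ∈ F i, n ≤ k) ∧
        (∀ i j, i < j → ∀ a ∈ F i, ∀ b ∈ F j, a < b) ∧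
        G = Finset.univ.biUnion F} ∪ {∅} := by
  rw [schreier, Ordinal.limitRecOn_add_one]
  rfl

theorem schreier_limit (s : LimitApproximation) (ξ : Ordinal.{0}) (hξ : Order.IsSuccLimit ξ)
    (hξ' : ξ < ω₁) :
    schreier s ξ = ⋃ n : ℕ+, {F | F ∈ schreier s (s.seq ξ n) ∧ ∀ k ∈ F, n ≤ k} := by
  rw [schreier, Ordinal.limitRecOn_limit _ _ _ _ hξ]
  ext F
  simp only [Set.mem_ofPred_eq, Set.mem_iUnion]
  exact ⟨fun ⟨n, _, h⟩ => ⟨n, h⟩, fun ⟨n, h⟩ => ⟨n, s.seq_lt ξ hξ hξ' n, h⟩⟩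

section Operators

variable (𝕜 : Type*) [RCLike 𝕜]
variable {X : Type*} [NormedAddCommGroup X] [NormedSpace 𝕜 X]
variable {Y : Type*} [NormedAddCommGroup Y] [NormedSpace 𝕜 Y]

/-- `(x_n)_{n ≥ 1}` is a normalized basic sequence: all `x_n` have norm one and `(x_n)` is a
Schauder basis of its closed linear span. -/
def IsNormalizedBasicSeq (x : ℕ+ → X) : Prop :=
  (∀ n, ‖x n‖ = 1) ∧
    ∃ b : SchauderBasis 𝕜 (Submodule.span 𝕜 (Set.range x)).topologicalClosure,
      ∀ i : ℕ, (b.basis i : X) = x i.succPNat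

variable {𝕜}

/-- `T` is strictly singular: its restriction to any (closed) infinite dimensional subspace `Z` is
not an isomorphism of `Z` onto its image `T(Z)`. -/
def IsStrictlySingular (T : X →L[𝕜] Y) : Prop :=
  ∀ Z : Submodule 𝕜 X, IsClosed (Z : Set X) → ¬ FiniteDimensional 𝕜 Z →
    ¬ ∃ e : Z ≃L[𝕜] Z.map (T : X →ₗ[𝕜] Y), ∀ z : Z, (e z : Y) = T z

/-- `T` is `𝓐`-strictly singular, for a collection `𝓐` of finite sets of positive integers.
The linear span of finitely many vectors is automatically closed. -/
def IsFamilyStrictlySingular (𝓐 : Set (Finset ℕ+)) (T : X →L[𝕜] Y) : Prop :=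
  ∀ ε : ℝ, 0 < ε → ∀ x : ℕ+ → X, IsNormalizedBasicSeq 𝕜 x →
    ∃ F ∈ 𝓐, ∃ z ∈ Submodule.span 𝕜 (x '' (F : Set ℕ+)), z ≠ 0 ∧ ‖T z‖ < ε * ‖z‖

variable (𝕜 X Y)

/-- `SS(X, Y)`. -/
def strictlySingularOperators : Set (X →L[𝕜] Y) := {T | IsStrictlySingular T}

/-- `SS_ξ(X, Y)`, the `S_ξ`-strictly singular operators. -/
def schreierSingularOperators (s : LimitApproximation) (ξ : Ordinal.{0}) : Set (X →L[𝕜] Y) :=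
  {T | IsFamilyStrictlySingular (schreier s ξ) T}

/-- `X` and `Y` are totally incomparable: no (closed) infinite dimensional subspace of `X` is
isomorphic to a (closed) subspace of `Y`. -/
def TotallyIncomparable : Prop :=
  ∀ (Z : Submodule 𝕜 X) (W : Submodule 𝕜 Y), IsClosed (Z : Set X) → IsClosed (W : Set Y) →
    ¬ FiniteDimensional 𝕜 Z → IsEmpty (Z ≃L[𝕜] W)

end Operators

/-!
The proof is a fusion argument over the countable ordinals. Suppose that every operator is strictly
singular but that for each `ξ < ω₁` some operator `T_ξ` is not `S_ξ`-strictly singular, as witnessed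
by `ε_ξ` and a normalized basic sequence `x^ξ`. Since `ω₁` has uncountable cofinality, one constant
`C` bounds `‖T_ξ‖`, `1 / ε_ξ` and the norms of the coefficient functionals of `x^ξ` for unboundedly
many `ξ`.

Call `(e_0, …, e_{n-1})` good for `T` if `‖v‖ ≤ C ‖T v‖` and `|a_j| ≤ C ‖v‖` for every
`v = ∑ a_i e_i`. Every `F ∈ S_ξ` gives a tuple `(x^ξ_k)_{k ∈ F}` which is good for `T_ξ`. As the
tree of sets in `S_ξ`, ordered by end-extension, has ordinal rank at least `ξ` (`rankGE_schreier`),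
so has the tree of tuples that are good for `T_ξ`.

It remains to find one operator with an infinite good sequence. Fix a dense sequence `d` in `X`, and
code `T` and `e` by the sequence of points `(T d_i, e_i)` of the Polish space `Y × X`; a finite
sequence belongs to `OperatorTree` if its first components are values of some operator of norm at
most `C` for which its second components are good. This tree has rank at least `α` for every
`α < ω₁`. By `exists_tendsto_of_forall_rankGE` it then has elements of
every length which converge coordinatewise: in a second countable space, any family indexed by the
countable ordinals has a member all of whose neighbourhoods contain unboundedly many members
(`exists_forall_isOpen_frequently`), so that one can extend the finite sequences one step at a time,
moving the earlier coordinates by at most `2⁻ⁿ` and keeping all ranks `α < ω₁` available nearby.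
The operators are bounded by `C` and converge on a dense set, hence pointwise, and the limit `T`
with the limit sequence `e` inherits the two inequalities. So `e` is linearly independent and `T` is
bounded below on the closed span of `e`, which contradicts strict singularity.

If `X` and `Y` are totally incomparable, every operator is strictly singular, because an isomorphic
image of a complete subspace is complete, hence closed.
-/

open scoped Ordinal
open Filter Topology

/-! ### Trees of finite sequences and their ranks -/

/-- The tree `Q` of finite sequences in `A` has rank at least `α` at the node `(p_0, …, p_{n-1})`.
A node of length `n` is encoded by an infinite sequence `p` together with `n`; `Q n p` says that the
node lies in the tree, and is meant to depend on the first `n` terms of `p` only. -/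
def RankGE {A : Type*} (Q : ℕ → (ℕ → A) → Prop) (α : Ordinal.{0}) (n : ℕ) (p : ℕ → A) : Prop :=
  Q n p ∧ ∀ β < α, ∃ q : ℕ → A, (∀ i < n, q i = p i) ∧ RankGE Q β (n + 1) q
termination_by α

theorem RankGE.mono {A : Type*} {Q : ℕ → (ℕ → A) → Prop} {α β : Ordinal.{0}} {n : ℕ}
    {p : ℕ → A} (h : RankGE Q α n p) (hβ : β ≤ α) : RankGE Q β n p := by
  rw [RankGE] at h ⊢
  exact ⟨h.1, fun γ hγ => h.2 γ (hγ.trans_le hβ)⟩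

/-- A map between trees that adds `c` to the length of nodes and preserves end-extension does not
decrease ranks. -/
theorem RankGE.map {A B : Type*} {Q : ℕ → (ℕ → A) → Prop} {R : ℕ → (ℕ → B) → Prop}
    (c : ℕ) (φ : (ℕ → A) → ℕ → B) (hQ : ∀ n p, Q n p → R (n + c) (φ p))
    (hφ : ∀ n p q, (∀ i < n, q i = p i) → ∀ i < n + c, φ q i = φ p i)
    {α : Ordinal.{0}} : ∀ {n : ℕ} {p : ℕ → A}, RankGE Q α n p → RankGE R α (n + c) (φ p) := by
  induction α using WellFoundedLT.induction with
  | ind α ih =>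
    intro n p h
    rw [RankGE] at h ⊢
    refine ⟨hQ n p h.1, fun β hβ => ?_⟩
    obtain ⟨q, hqp, hq⟩ := h.2 β hβ
    refine ⟨φ q, hφ n p q hqp, ?_⟩
    rw [Nat.add_right_comm]
    exact ih β hβ hq

/-! ### Fusion over the countable ordinals -/

/-- Otherwise each `p σ` would have a basic neighbourhood containing only boundedly many `p β`;
there are countably many basic open sets, and the supremum of their bounds is a countable
ordinal. -/
theorem exists_forall_isOpen_frequently {E : Type*} [TopologicalSpace E]
    [SecondCountableTopology E] (p : Ordinal.{0} → E) :
    ∃ σ < ω₁, ∀ U : Set E, IsOpen U → p σ ∈ U → ∀ α < ω₁, ∃ β, α ≤ β ∧ β < ω₁ ∧ p β ∈ U := by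
  classical
  obtain ⟨b, hbc, -, hb⟩ := TopologicalSpace.exists_countable_basis E
  have : Countable b := hbc.to_subtype
  -- `f U` bounds the indices `β` with `p β ∈ U`, for those basic open `U` that admit a bound.
  have key : ∀ U : b, ∃ γ < ω₁, (∃ α < ω₁, ∀ β, α ≤ β → β < ω₁ → p β ∉ (U : Set E)) →
      ∀ β, γ ≤ β → β < ω₁ → p β ∉ (U : Set E) := by
    intro U
    by_cases h : ∃ α < ω₁, ∀ β, α ≤ β → β < ω₁ → p β ∉ (U : Set E)
    · obtain ⟨α, hα, h⟩ := h
      exact ⟨α, hα, fun _ => h⟩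
    · exact ⟨0, Ordinal.omega_pos 1, fun h' => absurd h' h⟩
  choose f hf hfU using key
  obtain ⟨e, he⟩ := exists_injective_nat b
  -- `b` may live in a higher universe than the ordinals, so the supremum of `f` is taken over `ℕ`.
  let g : ℕ → Ordinal.{0} := fun n => if h : ∃ U, e U = n then f h.choose else 0
  have hg : ∀ U, f U = g (e U) := by
    intro U
    have h : ∃ V, e V = e U := ⟨U, rfl⟩
    simp only [g, dif_pos h]
    rw [he h.choose_spec]
  have hgω : ∀ n, g n < ω₁ := by
    intro n
    simp only [g]
    split_ifs
    · exact hf _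
    · exact Ordinal.omega_pos 1
  refine ⟨⨆ n, g n, Ordinal.iSup_lt_omega_one hgω, fun U hU hpU α hα => ?_⟩
  obtain ⟨V, hVb, hpV, hVU⟩ := hb.exists_subset_of_mem_open hpU hU
  by_contra! hcon
  refine hfU ⟨V, hVb⟩ ⟨α, hα, fun β h1 h2 h3 => hcon β h1 h2 (hVU h3)⟩ _ ?_
    (Ordinal.iSup_lt_omega_one hgω) hpV
  rw [hg]
  exact Ordinal.le_iSup g _

/-- An arbitrary tree over a Polish space which has rank at least `α` for every `α < ω₁` need not
have an infinite branch, but it has nodes `p n` of every length `n` that converge coordinatewise. -/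
theorem exists_tendsto_of_forall_rankGE {W : Type*} [PseudoMetricSpace W]
    [SecondCountableTopology W] [CompleteSpace W] {Q : ℕ → (ℕ → W) → Prop}
    (h : ∀ α < ω₁, ∃ p, RankGE Q α 0 p) :
    ∃ (p : ℕ → ℕ → W) (w : ℕ → W), (∀ n, Q n (p n)) ∧
      ∀ i, Tendsto (fun n => p n i) atTop (𝓝 (w i)) := by
  -- `G n c`: near `c` there are nodes of length `n` of every rank below `ω₁`.
  let G : ℕ → (ℕ → W) → Prop := fun n c => Q n c ∧
    ∀ α < ω₁, ∃ p, RankGE Q α n p ∧ ∀ i < n, dist (p i) (c i) < (1 / 2 : ℝ) ^ n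
  have cond : ∀ (n : ℕ) (p : Ordinal.{0} → ℕ → W), (∀ α < ω₁, RankGE Q α n (p α)) →
      ∃ σ < ω₁, G n (p σ) := by
    intro n p hp
    obtain ⟨σ, hσ, hU⟩ := exists_forall_isOpen_frequently p
    have hQ := hp σ hσ
    rw [RankGE] at hQ
    refine ⟨σ, hσ, hQ.1, fun α hα => ?_⟩
    obtain ⟨β, hαβ, hβ, hmem⟩ := hU
      (⋂ i ∈ Finset.range n, {q | dist (q i) (p σ i) < (1 / 2 : ℝ) ^ n})
      (isOpen_biInter_finset fun i _ => isOpen_lt (by fun_prop) continuous_const)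
      (by simp) α hα
    refine ⟨p β, (hp β hβ).mono hαβ, fun i hi => ?_⟩
    simp only [Set.mem_iInter, Finset.mem_range] at hmem
    exact hmem i hi
  have step : ∀ n c, G n c → ∃ c', G (n + 1) c' ∧ ∀ i < n, dist (c i) (c' i) ≤ (1 / 2 : ℝ) ^ n := by
    intro n c hc
    have : ∀ α : Ordinal.{0}, ∃ p, α < ω₁ → RankGE Q α (n + 1) p ∧
        ∀ i < n, dist (p i) (c i) < (1 / 2 : ℝ) ^ n := by
      intro α
      by_cases hα : α < ω₁
      · obtain ⟨p, hp, hpc⟩ := hc.2 (α + 1)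
          ((Cardinal.isSuccLimit_omega 1).succ_lt hα)
        rw [RankGE] at hp
        obtain ⟨q, hqp, hq⟩ := hp.2 α (Order.lt_succ α)
        exact ⟨q, fun _ => ⟨hq, fun i hi => by rw [hqp i hi]; exact hpc i hi⟩⟩
      · exact ⟨c, fun h => absurd h hα⟩
    choose p hp using this
    obtain ⟨σ, hσ, hG⟩ := cond (n + 1) p fun α hα => (hp α hα).1
    exact ⟨p σ, hG, fun i hi => by rw [dist_comm]; exact ((hp σ hσ).2 i hi).le⟩
  have base : ∃ c, G 0 c := by
    obtain ⟨p₀, -⟩ := h 0 (Ordinal.omega_pos 1)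
    have : ∀ α : Ordinal.{0}, ∃ p, α < ω₁ → RankGE Q α 0 p := fun α => by
      by_cases hα : α < ω₁
      · obtain ⟨p, hp⟩ := h α hα
        exact ⟨p, fun _ => hp⟩
      · exact ⟨p₀, fun h => absurd h hα⟩
    choose p hp using this
    obtain ⟨σ, -, hG⟩ := cond 0 p hp
    exact ⟨_, hG⟩
  choose! f hfG hfd using step
  obtain ⟨c₀, hc₀⟩ := base
  let p : ℕ → ℕ → W := fun n => Nat.rec c₀ (fun n c => f n c) n
  have hp : ∀ n, G n (p n) := fun n => by
    induction n with
    | zero => exact hc₀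
    | succ n ih => exact hfG n _ ih
  have lim : ∀ i, ∃ w, Tendsto (fun n => p n i) atTop (𝓝 w) := by
    intro i
    have hc : CauchySeq (fun n => p (n + (i + 1)) i) := by
      refine cauchySeq_of_le_geometric (1 / 2) 1 (by norm_num) fun n => ?_
      rw [one_mul, Nat.add_right_comm]
      refine (hfd _ _ (hp (n + (i + 1))) i (by omega)).trans ?_
      exact pow_le_pow_of_le_one (by norm_num) (by norm_num) (by omega)
    obtain ⟨w, hw⟩ := cauchySeq_tendsto_of_complete hc
    exact ⟨w, (tendsto_add_atTop_iff_nat (i + 1)).1 hw⟩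
  choose w hw using lim
  exact ⟨p, w, fun n => (hp n).1, hw⟩

/-! ### The rank of the Schreier families -/

/-- The tree of increasing enumerations `(m_0 < ⋯ < m_{n-1})` of the members of a family of finite
sets. -/
def FamilyTree (𝓐 : Set (Finset ℕ+)) (n : ℕ) (m : ℕ → ℕ+) : Prop :=
  StrictMonoOn m (Set.Iio n) ∧ (Finset.range n).image m ∈ 𝓐

theorem empty_mem_schreier (s : LimitApproximation) {ξ : Ordinal.{0}} (hξ : ξ < ω₁) :
    ∅ ∈ schreier s ξ := by
  induction ξ using Ordinal.limitRecOn with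
  | zero => simp [schreier_zero]
  | add_one ζ _ => simp [schreier_add_one]
  | limit ξ hl ih =>
    rw [schreier_limit s ξ hl hξ]
    exact Set.mem_iUnion.2 ⟨1, ih _ (s.seq_lt ξ hl hξ 1) ((s.seq_lt ξ hl hξ 1).trans hξ), by simp⟩

theorem singleton_mem_schreier (s : LimitApproximation) (k : ℕ+) {ξ : Ordinal.{0}}
    (hξ : ξ < ω₁) : {k} ∈ schreier s ξ := by
  induction ξ using Ordinal.limitRecOn with
  | zero => simp [schreier_zero]
  | add_one ζ ih =>
    rw [schreier_add_one]
    refine Or.inl ⟨1, fun _ => {k}, fun _ => ih ((Order.lt_succ ζ).trans hξ), by simp, ?_, ?_⟩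
    · intro i j hij
      have := i.2; have := j.2; have : (i : ℕ) < j := hij
      simp only [PNat.one_coe] at *
      omega
    · ext a
      simp only [Finset.mem_biUnion, Finset.mem_singleton]
      exact ⟨fun h => ⟨⟨0, Nat.one_pos⟩, Finset.mem_univ _, h⟩, fun ⟨_, _, h⟩ => h⟩
  | limit ξ hl ih =>
    rw [schreier_limit s ξ hl hξ]
    exact Set.mem_iUnion.2 ⟨1, ih _ (s.seq_lt ξ hl hξ 1) ((s.seq_lt ξ hl hξ 1).trans hξ), by simp⟩

theorem insert_mem_schreier_add_one (s : LimitApproximation) {ζ : Ordinal.{0}} (hζ : ζ < ω₁)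
    {k : ℕ+} (hk : 2 ≤ k) {G : Finset ℕ+} (hG : G ∈ schreier s ζ) (hkG : ∀ g ∈ G, k < g) :
    insert k G ∈ schreier s (ζ + 1) := by
  rw [schreier_add_one]
  refine Or.inl ⟨2, (![{k}, G] : Fin 2 → Finset ℕ+), ?_, ?_, ?_, ?_⟩
  · exact Fin.forall_fin_two.2 ⟨singleton_mem_schreier s k hζ, hG⟩
  · refine Fin.forall_fin_two.2 ⟨by simpa using hk, fun g hg => hk.trans (hkG g hg).le⟩
  · refine Fin.forall_fin_two.2
      ⟨Fin.forall_fin_two.2 ⟨fun h => absurd h (lt_irrefl _), fun _ => ?_⟩,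
      Fin.forall_fin_two.2 ⟨fun h => absurd h (by decide), fun h => absurd h (lt_irrefl _)⟩⟩
    simpa using hkG
  · ext a
    change _ ↔ a ∈ (Finset.univ : Finset (Fin 2)).biUnion _
    simp [Fin.exists_fin_two]

/-- The tree of `S_ξ` has rank at least `ξ`. The induction needs this for the members of `S_ξ` that
lie beyond an arbitrary `N`: the successor step puts one element `k` in front of sets in `S_ζ`
beyond `k`, and the limit step passes to `S_{ξ_n}` beyond `n`. -/
theorem rankGE_schreier (s : LimitApproximation) {ξ : Ordinal.{0}} (hξ : ξ < ω₁) :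
    ∀ (N : ℕ+) (m : ℕ → ℕ+),
      RankGE (FamilyTree {F | F ∈ schreier s ξ ∧ ∀ k ∈ F, N ≤ k}) ξ 0 m := by
  have h0 : ∀ {ξ : Ordinal.{0}}, ξ < ω₁ → ∀ (N : ℕ+) (m : ℕ → ℕ+),
      FamilyTree {F | F ∈ schreier s ξ ∧ ∀ k ∈ F, N ≤ k} 0 m := fun hξ N m =>
    ⟨fun i hi => absurd hi (Nat.not_lt_zero i), by simpa using empty_mem_schreier s hξ⟩
  induction ξ using Ordinal.limitRecOn with
  | zero =>
    intro N m
    rw [RankGE]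
    exact ⟨h0 hξ N m, fun β hβ => absurd hβ (not_lt_bot)⟩
  | add_one ζ ih =>
    intro N m
    have hζ : ζ < ω₁ := (Order.lt_succ ζ).trans hξ
    rw [RankGE]
    refine ⟨h0 hξ N m, fun β hβ => ?_⟩
    -- Two blocks, `{k}` and a set in `S_ζ` beyond `k`, are allowed in `S_{ζ+1}` once `2 ≤ k`.
    have hk : 2 ≤ max N 2 := le_max_right _ _
    have hN : N ≤ max N 2 := le_max_left _ _
    generalize max N 2 = k at hk hN
    refine ⟨fun i => Nat.casesOn i k m, by simp, ?_⟩
    refine (RankGE.map (R := FamilyTree {F | F ∈ schreier s (ζ + 1) ∧ ∀ k ∈ F, N ≤ k}) 1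
      (fun q i => Nat.casesOn i k q) ?_ ?_ (ih hζ (k + 1) m)).mono (Order.lt_succ_iff.1 hβ)
    · rintro n q ⟨hmono, hmem, hq⟩
      have hkq : ∀ i < n, k < q i := fun i hi =>
        PNat.add_one_le_iff.1 (hq _ (Finset.mem_image_of_mem _ (Finset.mem_range.2 hi)))
      refine ⟨?_, ?_⟩
      · rintro (_ | i) hi (_ | j) hj hij
        · exact absurd hij (lt_irrefl _)
        · exact hkq j (Nat.lt_of_succ_lt_succ hj)
        · exact absurd hij (Nat.not_lt_zero _)
        · exact hmono (Nat.lt_of_succ_lt_succ hi) (Nat.lt_of_succ_lt_succ hj)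
            (Nat.lt_of_succ_lt_succ hij)
      · have himg : (Finset.range (n + 1)).image (fun i => (Nat.casesOn i k q : ℕ+)) =
            insert k ((Finset.range n).image q) := by
          rw [Finset.range_add_one', Finset.image_insert, Finset.map_eq_image, Finset.image_image]
          rfl
        rw [himg]
        refine ⟨insert_mem_schreier_add_one s hζ hk hmem ?_, ?_⟩
        · simpa using hkq
        · simp only [Finset.mem_insert, Finset.mem_image, Finset.mem_range]
          rintro a (rfl | ⟨i, hi, rfl⟩)
          · exact hN
          · exact hN.trans (hkq i hi).le
    · rintro n p q hpq (_ | i) hi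
      · rfl
      · exact hpq i (Nat.lt_of_succ_lt_succ hi)
  | limit ξ hl ih =>
    intro N m
    rw [RankGE]
    refine ⟨h0 hξ N m, fun β hβ => ?_⟩
    obtain ⟨n, hn⟩ := s.seq_cofinal ξ hl hξ β hβ
    have hlt := s.seq_lt ξ hl hξ n
    have hr := RankGE.map (R := FamilyTree {F | F ∈ schreier s ξ ∧ ∀ k ∈ F, N ≤ k}) 0 id
      (fun j q hq => ⟨hq.1, ?_, fun k hk => (le_max_right n N).trans (hq.2.2 k hk)⟩)
      (fun j p q h => h) (ih _ hlt (hlt.trans hξ) (max n N) m)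
    · rw [RankGE] at hr
      exact hr.2 β hn
    · rw [schreier_limit s ξ hl hξ]
      exact Set.mem_iUnion.2 ⟨n, hq.2.1, fun k hk => (le_max_left n N).trans (hq.2.2 k hk)⟩

/-! ### Normalized basic sequences and strictly singular operators -/

section
variable {𝕜 : Type*} [RCLike 𝕜] {X : Type*} [NormedAddCommGroup X] [NormedSpace 𝕜 X]
  {Y : Type*} [NormedAddCommGroup Y] [NormedSpace 𝕜 Y]

/-- The coefficient functionals of a normalized basic sequence are uniformly bounded, being
differences of consecutive basis projections. This is stated for finite combinations of distinct
members `x (m i)` of the sequence. -/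
theorem IsNormalizedBasicSeq.exists_norm_coeff_le [CompleteSpace X] {x : ℕ+ → X}
    (hx : IsNormalizedBasicSeq 𝕜 x) :
    ∃ C : ℝ, ∀ (n : ℕ) (m : ℕ → ℕ+), Set.InjOn m (Set.Iio n) → ∀ (a : ℕ → 𝕜), ∀ j < n,
      ‖a j‖ ≤ C * ‖∑ i ∈ Finset.range n, a i • x (m i)‖ := by
  obtain ⟨hnorm, b, hb⟩ := hx
  have : CompleteSpace (Submodule.span 𝕜 (Set.range x)).topologicalClosure :=
    (Submodule.isClosed_topologicalClosure _).completeSpace_coe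
  obtain ⟨C, hC⟩ := b.exists_norm_proj_le
  have hcoord : ∀ n z, ‖b.coord n z‖ ≤ (C + C) * ‖z‖ := by
    intro n z
    have h1 : b.coord n z • b.basis n = b.proj (n + 1) z - b.proj n z := by
      rw [b.proj_apply, b.proj_apply, Finset.sum_range_succ, add_sub_cancel_left]
    have h2 : ‖b.basis n‖ = 1 := (congrArg norm (hb n)).trans (hnorm _)
    calc ‖b.coord n z‖ = ‖b.proj (n + 1) z - b.proj n z‖ := by
          rw [← h1, norm_smul, h2, mul_one]
      _ ≤ ‖b.proj (n + 1) z‖ + ‖b.proj n z‖ := norm_sub_le _ _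
      _ ≤ C * ‖z‖ + C * ‖z‖ := add_le_add ((b.proj (n + 1)).le_of_opNorm_le (hC _) z)
          ((b.proj n).le_of_opNorm_le (hC _) z)
      _ = (C + C) * ‖z‖ := by ring
  refine ⟨C + C, fun n m hm a j hj => ?_⟩
  have hxb : ∀ k : ℕ+, x k = b.basis k.natPred := fun k => by
    rw [hb, PNat.succPNat_natPred]
  have hsum : ∑ i ∈ Finset.range n, a i • x (m i) =
      ((∑ i ∈ Finset.range n, a i • b.basis (m i).natPred :
        (Submodule.span 𝕜 (Set.range x)).topologicalClosure) : X) := by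
    simp [hxb]
  have hj' : b.coord (m j).natPred (∑ i ∈ Finset.range n, a i • b.basis (m i).natPred) = a j := by
    rw [map_sum, Finset.sum_eq_single j]
    · simp [b.ortho]
    · intro i hi hij
      have hne : (m i).natPred ≠ (m j).natPred := fun h =>
        hij (hm (Finset.mem_range.1 hi) hj (PNat.natPred_injective h))
      simp [b.ortho, hne]
    · exact fun h => absurd (Finset.mem_range.2 hj) h
  rw [hsum, ← hj']
  exact hcoord _ _

theorem not_isStrictlySingular_of_antilipschitz_on_span {T : X →L[𝕜] Y} {C : ℝ}
    {e : ℕ → X} (he : LinearIndependent 𝕜 e)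
    (hT : ∀ v ∈ Submodule.span 𝕜 (Set.range e), ‖v‖ ≤ C * ‖T v‖) : ¬ IsStrictlySingular T := by
  intro hss
  set Z := (Submodule.span 𝕜 (Set.range e)).topologicalClosure with hZ
  have heZ : ∀ i, e i ∈ Z := fun i =>
    Submodule.le_topologicalClosure _ (Submodule.subset_span ⟨i, rfl⟩)
  have hTZ : ∀ v ∈ Z, ‖v‖ ≤ C * ‖T v‖ := by
    intro v hv
    have hcl : IsClosed {v : X | ‖v‖ ≤ C * ‖T v‖} := isClosed_le (by fun_prop) (by fun_prop)
    exact closure_minimal (s := (Submodule.span 𝕜 (Set.range e) : Set X)) hT hcl hv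
  have hinf : ¬ FiniteDimensional 𝕜 Z := by
    intro hfin
    have hli : LinearIndependent 𝕜 (fun i => (⟨e i, heZ i⟩ : Z)) :=
      LinearIndependent.of_comp Z.subtype he
    exact Set.infinite_univ (Set.finite_univ_iff.2 hli.finite)
  have hinj : Function.Injective ((T : X →ₗ[𝕜] Y).submoduleMap Z) := by
    rw [injective_iff_map_eq_zero]
    intro z hz
    have hz' : T z = 0 := congrArg Subtype.val hz
    have := hTZ z z.2
    rw [hz', norm_zero, mul_zero] at this
    exact Subtype.ext (norm_le_zero_iff.1 this)
  let E : Z ≃ₗ[𝕜] Z.map (T : X →ₗ[𝕜] Y) := LinearEquiv.ofBijective _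
    ⟨hinj, (T : X →ₗ[𝕜] Y).submoduleMap_surjective Z⟩
  refine hss Z (Submodule.isClosed_topologicalClosure _) hinf
    ⟨E.toContinuousLinearEquivOfBounds ‖T‖ C (fun z => T.le_opNorm z) (fun y => ?_), fun z => rfl⟩
  obtain ⟨z, rfl⟩ := E.surjective y
  rw [E.symm_apply_apply]
  exact hTZ z z.2

/-! ### Limits of operators -/

theorem exists_tendsto_of_cauchySeq_denseRange [CompleteSpace Y] {T : ℕ → X →L[𝕜] Y} {C : ℝ}
    (hC : ∀ n, ‖T n‖ ≤ C) {d : ℕ → X} (hd : DenseRange d)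
    (h : ∀ i, CauchySeq fun n => T n (d i)) :
    ∃ S : X →L[𝕜] Y, ∀ x, Tendsto (fun n => T n x) atTop (𝓝 (S x)) := by
  have hC0 : 0 ≤ C := (norm_nonneg _).trans (hC 0)
  have hcauchy : ∀ x, CauchySeq fun n => T n x := by
    intro x
    rw [Metric.cauchySeq_iff]
    intro ε hε
    obtain ⟨i, hi⟩ := hd.exists_dist_lt x (ε := ε / (3 * (C + 1))) (by positivity)
    have hi' : C * ‖x - d i‖ ≤ ε / 3 := by
      rw [dist_eq_norm, lt_div_iff₀ (by positivity)] at hi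
      nlinarith [norm_nonneg (x - d i)]
    have hx : ∀ n, ‖T n x - T n (d i)‖ ≤ ε / 3 := fun n => by
      rw [← map_sub]
      exact ((T n).le_of_opNorm_le (hC n) _).trans hi'
    obtain ⟨N, hN⟩ := Metric.cauchySeq_iff.1 (h i) (ε / 3) (by positivity)
    refine ⟨N, fun m hm n hn => ?_⟩
    have h1 := hN m hm n hn
    have h2 := hx m
    have h3 := hx n
    rw [← dist_eq_norm] at h2 h3
    rw [dist_comm] at h3
    linarith [dist_triangle4 (T m x) (T m (d i)) (T n (d i)) (T n x)]
  choose S hS using fun x => cauchySeq_tendsto_of_complete (hcauchy x)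
  let L : X →ₗ[𝕜] Y :=
    { toFun := S
      map_add' := fun x y => tendsto_nhds_unique (hS (x + y)) <| by
        simpa using (hS x).add (hS y)
      map_smul' := fun c x => tendsto_nhds_unique (hS (c • x)) <| by
        simpa using (hS x).const_smul c }
  exact ⟨L.mkContinuous C fun x =>
    le_of_tendsto (hS x).norm (Eventually.of_forall fun n => (T n).le_of_opNorm_le (hC n) x), hS⟩

variable (𝕜) in
/-- The tree of finite sequences `(T d_i, e_i)_{i < n}`, where `‖T‖ ≤ C`, the operator `T` is
bounded below by `C⁻¹` on the span of the `e_i`, and the coefficient functionals of the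
`e_i` are bounded by `C`. The operator may change along an extension; only its values at `d_0, …, d_{n-1}` are
recorded. -/
def OperatorTree (C : ℝ) (d : ℕ → X) (n : ℕ) (p : ℕ → Y × X) : Prop :=
  ∃ T : X →L[𝕜] Y, ‖T‖ ≤ C ∧ (∀ i < n, (p i).1 = T (d i)) ∧
    ∀ a : ℕ → 𝕜,
      ‖∑ i ∈ Finset.range n, a i • (p i).2‖ ≤ C * ‖T (∑ i ∈ Finset.range n, a i • (p i).2)‖ ∧
      ∀ j < n, ‖a j‖ ≤ C * ‖∑ i ∈ Finset.range n, a i • (p i).2‖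

/-- The conditions defining `OperatorTree` pass to coordinatewise limits. -/
theorem exists_not_isStrictlySingular_of_tendsto [CompleteSpace Y] {C : ℝ} {d : ℕ → X}
    (hd : DenseRange d) {p : ℕ → ℕ → Y × X} {w : ℕ → Y × X}
    (hp : ∀ n, OperatorTree 𝕜 C d n (p n)) (hw : ∀ i, Tendsto (fun n => p n i) atTop (𝓝 (w i))) :
    ∃ T : X →L[𝕜] Y, ¬ IsStrictlySingular T := by
  choose T hTC hTd hTa using hp
  have hC0 : 0 ≤ C := (norm_nonneg _).trans (hTC 0)
  obtain ⟨S, hS⟩ := exists_tendsto_of_cauchySeq_denseRange hTC hd fun i => by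
    refine ((continuous_fst.tendsto _).comp (hw i) |>.congr' ?_).cauchySeq
    filter_upwards [eventually_gt_atTop i] with n hn
    exact hTd n i hn
  -- The limits `w` satisfy the two inequalities at every length `k`.
  have hmain : ∀ (k : ℕ) (a : ℕ → 𝕜),
      ‖∑ i ∈ Finset.range k, a i • (w i).2‖ ≤ C * ‖S (∑ i ∈ Finset.range k, a i • (w i).2)‖ ∧
      ∀ j < k, ‖a j‖ ≤ C * ‖∑ i ∈ Finset.range k, a i • (w i).2‖ := by
    intro k a
    set v := ∑ i ∈ Finset.range k, a i • (w i).2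
    let u : ℕ → X := fun n => ∑ i ∈ Finset.range k, a i • (p n i).2
    have hu : Tendsto u atTop (𝓝 v) := tendsto_finsetSum _ fun i _ =>
      ((continuous_snd.tendsto _).comp (hw i)).const_smul (a i)
    have hTu : Tendsto (fun n => T n (u n)) atTop (𝓝 (S v)) := by
      have h0 : Tendsto (fun n => T n (u n - v)) atTop (𝓝 0) := by
        refine squeeze_zero_norm (fun n => (T n).le_of_opNorm_le (hTC n) _) ?_
        simpa using ((hu.sub_const v).norm).const_mul C
      simpa using h0.add (hS v)
    have hbound : ∀ n, k ≤ n → ‖u n‖ ≤ C * ‖T n (u n)‖ ∧ ∀ j < k, ‖a j‖ ≤ C * ‖u n‖ := by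
      intro n hkn
      -- Padding the coefficients by zeros turns the condition at level `n` into one at level `k`.
      have hsum : ∑ i ∈ Finset.range n, (if i < k then a i else 0) • (p n i).2 = u n := by
        rw [← Finset.sum_subset (Finset.range_subset_range.2 hkn)]
        · exact Finset.sum_congr rfl fun i hi => by rw [if_pos (Finset.mem_range.1 hi)]
        · intro i _ hi
          rw [if_neg (by simpa using hi), zero_smul]
      have h := hTa n fun i => if i < k then a i else 0
      rw [hsum] at h
      refine ⟨h.1, fun j hj => ?_⟩
      simpa only [if_pos hj] using h.2 j (hj.trans_le hkn)
    refine ⟨le_of_tendsto_of_tendsto hu.norm (hTu.norm.const_mul C) ?_, fun j hj =>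
      ge_of_tendsto (hu.norm.const_mul C) ?_⟩
    · filter_upwards [eventually_ge_atTop k] with n hn using (hbound n hn).1
    · filter_upwards [eventually_ge_atTop k] with n hn using (hbound n hn).2 j hj
  refine ⟨S, not_isStrictlySingular_of_antilipschitz_on_span (C := C) (e := fun i => (w i).2) ?_ ?_⟩
  · rw [linearIndependent_iff']
    intro s a ha i hi
    obtain ⟨k, hk⟩ := s.exists_nat_subset_range
    have hsum : ∑ i ∈ Finset.range k, (if i ∈ s then a i else 0) • (w i).2 = 0 := by
      rw [← ha, ← Finset.sum_subset hk]
      · exact Finset.sum_congr rfl fun i hi => by rw [if_pos hi]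
      · intro i _ hi
        rw [if_neg hi, zero_smul]
    have h := (hmain k fun i => if i ∈ s then a i else 0).2 i (Finset.mem_range.1 (hk hi))
    rw [hsum, norm_zero, mul_zero, if_pos hi] at h
    exact norm_le_zero_iff.1 h
  · intro v hv
    obtain ⟨a, rfl⟩ := (Finsupp.mem_span_range_iff_exists_finsupp).1 hv
    obtain ⟨k, hk⟩ := a.support.exists_nat_subset_range
    rw [Finsupp.sum_of_support_subset a hk _ (by simp)]
    exact (hmain k a).1

/-! ### The Schreier index of the strictly singular operators -/

theorem exists_forall_isFamilyStrictlySingular [CompleteSpace X]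
    [TopologicalSpace.SeparableSpace X] [CompleteSpace Y] [TopologicalSpace.SeparableSpace Y]
    (s : LimitApproximation) (hss : ∀ T : X →L[𝕜] Y, IsStrictlySingular T) :
    ∃ ξ : Ordinal.{0}, 1 ≤ ξ ∧ ξ < ω₁ ∧
      ∀ T : X →L[𝕜] Y, IsFamilyStrictlySingular (schreier s ξ) T := by
  by_contra! hcon
  have hd := TopologicalSpace.denseRange_denseSeq X
  set d := TopologicalSpace.denseSeq X
  have hrank : ∀ ξ : Ordinal.{0}, ∃ C : ℕ, 1 ≤ ξ → ξ < ω₁ →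
      ∃ p, RankGE (OperatorTree (X := X) (Y := Y) 𝕜 C d) ξ 0 p := by
    intro ξ
    by_cases hξ : 1 ≤ ξ ∧ ξ < ω₁
    swap
    · exact ⟨0, fun h1 h2 => absurd ⟨h1, h2⟩ hξ⟩
    obtain ⟨T, hT⟩ := hcon ξ hξ.1 hξ.2
    simp only [IsFamilyStrictlySingular, not_forall, not_exists, not_and, not_lt] at hT
    obtain ⟨ε, hε, x, hx, hT⟩ := hT
    obtain ⟨K, hK⟩ := hx.exists_norm_coeff_le
    obtain ⟨C, hC⟩ := exists_nat_ge (max ‖T‖ (max (1 / ε) K))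
    simp only [max_le_iff] at hC
    -- The members of `S_ξ` pick out nodes of the operator tree.
    refine ⟨C, fun _ _ => ⟨_, RankGE.map 0 (fun m i => (T (d i), x (m i))) ?_ ?_
      (rankGE_schreier s hξ.2 1 fun _ => 1)⟩⟩
    · rintro n m ⟨hmono, hmem, -⟩
      refine ⟨T, hC.1, fun _ _ => rfl, fun a => ⟨?_, fun j hj => ?_⟩⟩
      · let v := ∑ i ∈ Finset.range n, a i • x (m i)
        change ‖v‖ ≤ C * ‖T v‖
        rcases eq_or_ne v 0 with hv | hv
        · rw [hv, map_zero, norm_zero, norm_zero, mul_zero]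
        have h := hT _ hmem v (Submodule.sum_mem _ fun i hi => Submodule.smul_mem _ _ <|
          Submodule.subset_span ⟨m i, Finset.mem_coe.2 (Finset.mem_image_of_mem m hi), rfl⟩) hv
        calc ‖v‖ = 1 / ε * (ε * ‖v‖) := by field_simp
          _ ≤ 1 / ε * ‖T v‖ := by gcongr
          _ ≤ C * ‖T v‖ := by gcongr; exact hC.2.1
      · refine (hK n m hmono.injOn a j hj).trans ?_
        exact mul_le_mul_of_nonneg_right hC.2.2 (norm_nonneg _)
    · intro n m m' h i hi
      simp only [h i hi]
  choose C hC using hrank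
  -- In the discrete space `ℕ`, this selects a constant that works for unboundedly many `ξ`.
  obtain ⟨σ, -, hσ⟩ := exists_forall_isOpen_frequently C
  obtain ⟨p, w, hp, hw⟩ := exists_tendsto_of_forall_rankGE
    (Q := OperatorTree (X := X) (Y := Y) 𝕜 (C σ) d) fun α hα => by
      have h1 : max α 1 < ω₁ := max_lt hα (Ordinal.one_lt_omega0.trans Ordinal.omega0_lt_omega_one)
      obtain ⟨β, hαβ, hβ, hCβ⟩ := hσ {C σ} (isOpen_discrete _) rfl _ h1
      obtain ⟨p, hp⟩ := hC β ((le_max_right _ _).trans hαβ) hβ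
      rw [Set.mem_singleton_iff] at hCβ
      rw [hCβ] at hp
      exact ⟨p, hp.mono ((le_max_left _ _).trans hαβ)⟩
  obtain ⟨T, hT⟩ := exists_not_isStrictlySingular_of_tendsto hd hp hw
  exact hT (hss T)

theorem TotallyIncomparable.isStrictlySingular [CompleteSpace X]
    (h : TotallyIncomparable 𝕜 X Y) (T : X →L[𝕜] Y) : IsStrictlySingular T := by
  rintro Z hZ hinf ⟨e, -⟩
  have := hZ.completeSpace_coe
  have : CompleteSpace (Z.map (T : X →ₗ[𝕜] Y)) :=
    (completeSpace_congr (e := e.toEquiv) e.isUniformEmbedding).1 inferInstance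
  exact (h Z _ hZ (completeSpace_coe_iff_isComplete.1 this).isClosed hinf).false e

end

theorem mainTheorem7 {𝕜 : Type*} [RCLike 𝕜]
    (X : Type*) [NormedAddCommGroup X] [NormedSpace 𝕜 X] [CompleteSpace X]
    [TopologicalSpace.SeparableSpace X]
    (Y : Type*) [NormedAddCommGroup Y] [NormedSpace 𝕜 Y] [CompleteSpace Y]
    [TopologicalSpace.SeparableSpace Y]
    (s : LimitApproximation) :
    (strictlySingularOperators 𝕜 X Y = Set.univ →
      ∃ ξ : Ordinal.{0}, 1 ≤ ξ ∧ ξ < ω₁ ∧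
        schreierSingularOperators 𝕜 X Y s ξ = strictlySingularOperators 𝕜 X Y) ∧
    (TotallyIncomparable 𝕜 X Y →
      strictlySingularOperators 𝕜 X Y = Set.univ ∧
      ∃ ξ : Ordinal.{0}, 1 ≤ ξ ∧ ξ < ω₁ ∧
        schreierSingularOperators 𝕜 X Y s ξ = strictlySingularOperators 𝕜 X Y) := by
  have main : strictlySingularOperators 𝕜 X Y = Set.univ →
      ∃ ξ : Ordinal.{0}, 1 ≤ ξ ∧ ξ < ω₁ ∧
        schreierSingularOperators 𝕜 X Y s ξ = strictlySingularOperators 𝕜 X Y := by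
    intro h
    obtain ⟨ξ, h1, h2, h3⟩ := exists_forall_isFamilyStrictlySingular s
      (Set.eq_univ_iff_forall.1 h)
    exact ⟨ξ, h1, h2, (Set.eq_univ_iff_forall.2 h3).trans h.symm⟩
  refine ⟨main, fun h => ?_⟩
  have huniv : strictlySingularOperators 𝕜 X Y = Set.univ :=
    Set.eq_univ_iff_forall.2 h.isStrictlySingular
  exact ⟨huniv, main huniv⟩
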